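/- Write $[a,b]=\{a,a+1,\dots,b\}$ and $[n]=[1,n]$. For $1\le j<i\le n$ the $ij$-shift of a family $\mathcal A\subseteq\binom{[n]}{r}$ replaces each $A\in\mathcal A$ with $i\in A$, $j\notin A$ by $(A\setminus\{i\})\cup\{j\}$ whenever the latter is not in $\mathcal A$; $\mathcal A$ is left-compressed if it is unchanged by every $ij$-shift with $i>j$, and intersecting if no two members are disjoint. An MLCIF is a left-compressed intersecting family $\mathcal A\subseteq\binom{[n]}{r}$ that is maximal under inclusion among such families. For $X\subseteq[n]$ let $\mathrm{hit}_X(\mathcal A)=|\{A\in\mathcal A: A\cap X\neq\emptyset\}|$; an MLCIF is optimal for $X$ if it maximises $\mathrm{hit}_X$ among all MLCIFs (for the given $n$ and $r$). Let $\mathcal S=\{A\in\binom{[n]}{r}:1\in A\}$ be the star and, for $t\in[n]$, let $$\mathrm{AHM}_t=\{A\in\mathcal S: A\cap[2,t]\ne\emptyset\}\cup\{A\in\tbinom{[n]}{r}:[2,t]\subseteq A\}.$$ Theorem. For every $r\ge 3$ there is an $N=N(r)$ such that for every $n\ge N$ and every nonempty $X\subseteq[2,n]$ the following hold. (a) If $X=\{2\}$,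 then $\mathrm{AHM}_3$ is the only optimal MLCIF for $X$. (b) If $|X|=2$ and $X\cap\{2,3\}\ne\emptyset$, then the optimal MLCIFs for $X$ are exactly $\mathrm{AHM}_3$ if $4\notin X$, and exactly $\mathrm{AHM}_3$ and $\mathrm{AHM}_4$ if $4\in X$. (c) If $|X|=3$ and $\{2,3\}\subseteq X$, then the optimal MLCIFs for $X$ are exactly $\mathrm{AHM}_3$ if $X\ne\{2,3,4\}$, and exactly $\mathrm{AHM}_3$ and $\mathrm{AHM}_4$ if $X=\{2,3,4\}$. (d) If $X\subseteq[2,r+1]$ and $X$ is not as in (a)–(c), then $\mathrm{AHM}_{\max X}$ is the only optimal MLCIF for $X$. (e) If $X$ is not as in (a)–(d), then $\mathcal S$ is the only optimal MLCIF for $X$. -/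

import Mathlib

open Finset

/-- The complete `r`-uniform family on `[n] = {1, …, n}`. -/
def uniformSets (n r : ℕ) : Finset (Finset ℕ) :=
  powersetCard r (Icc 1 n)

/-- A family of subsets of `[n]` is left-compressed if it is fixed by the `ij`-shift for all
`i > j` in `[n]`. `UV.compression {j} {i} F` is this shift: every member `A` of `F` with `i ∈ A` and
`j ∉ A` is replaced by `(A \ {i}) ∪ {j}`, unless the latter already belongs to `F`. -/
def LeftCompressed (n : ℕ) (F : Finset (Finset ℕ)) : Prop :=
  ∀ i ∈ Icc 1 n, ∀ j ∈ Icc 1 n, j < i → UV.compression {j} {i} F = F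

/-- Left-compressed intersecting families of `r`-subsets of `[n]`. -/
def IsLCIF (n r : ℕ) (F : Finset (Finset ℕ)) : Prop :=
  F ⊆ uniformSets n r ∧ LeftCompressed n F ∧ (F : Set (Finset ℕ)).Intersecting

/-- Maximal (with respect to inclusion) left-compressed intersecting families of `r`-subsets
of `[n]`. -/
def IsMLCIF (n r : ℕ) (F : Finset (Finset ℕ)) : Prop :=
  Maximal (IsLCIF n r) F

/-- The hitting of a family `F` with a set `X`: the number of members of `F` that meet `X`. -/
def hit (X : Finset ℕ) (F : Finset (Finset ℕ)) : ℕ :=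
  #{A ∈ F | (A ∩ X).Nonempty}

/-- `F` is an optimal maximal left-compressed intersecting family for `X`. -/
def IsOptimalFor (n r : ℕ) (X : Finset ℕ) (F : Finset (Finset ℕ)) : Prop :=
  IsMLCIF n r F ∧ ∀ F' : Finset (Finset ℕ), IsMLCIF n r F' → hit X F' ≤ hit X F

/-- The star at `1`. -/
def star1 (n r : ℕ) : Finset (Finset ℕ) :=
  {A ∈ uniformSets n r | 1 ∈ A}

/-- The `t`-adjusted Hilton-Milner family. -/
def AHM (n r t : ℕ) : Finset (Finset ℕ) :=
  {A ∈ star1 n r | (A ∩ Icc 2 t).Nonempty} ∪ {A ∈ uniformSets n r | Icc 2 t ⊆ A}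

/-!
If a family `F` is left-compressed and intersecting, then any two members already meet inside
`[2r]`, since a pair of members with minimal intersection would otherwise admit a shift that makes
the intersection smaller. Hence the traces of `F` on `[2r]` generate a left-compressed intersecting
family, so a maximal `F` contains every superset of each of its traces. Unless `F` is `AHM n r 3`,
those traces that avoid `1` have at least three elements, so all but `O(n ^ (r - 3))` members of `F`
lie in the star. If moreover `F` misses some superset of `{1, y}`, where `y ∈ X`, then it misses of
order `n ^ (r - 2)` members of the star that contain `y`, and the star is better; for `X = {2}`, the
pair `{2, 3}` shows in the same way that `AHM n r 3` is better. If on the other hand `F` contains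
all supersets of `{1, m}`, where `m = max X`, then every member of `F` that meets `X` belongs to
`AHM n r m`. It remains to compare the star with the families `AHM n r t`. Passing from the star to
`AHM n r t` trades the sets with trace `{1}` on `[t]` for those with trace `[2, t]`, both of which
are counted by binomial coefficients.
-/

/-- The family of all `r`-subsets of `[n]` that include the set `G`. -/
def supersets (n r : ℕ) (G : Finset ℕ) : Finset (Finset ℕ) :=
  {A ∈ uniformSets n r | G ⊆ A}

/-- The family of `r`-subsets of `[n]` with generating family `𝒢`: those that include some member
of `𝒢`. -/
def generated (n r : ℕ) (𝒢 : Finset (Finset ℕ)) : Finset (Finset ℕ) :=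
  𝒢.biUnion (supersets n r)

/-- A generating family is shiftable if replacing an element of a member by a smaller one always
gives a superset of a member; generated families then are left-compressed. -/
def Shiftable (𝒢 : Finset (Finset ℕ)) : Prop :=
  ∀ G ∈ 𝒢, ∀ i ∈ G, ∀ j, 1 ≤ j → j < i → j ∉ G → ∃ G' ∈ 𝒢, G' ⊆ insert j (G.erase i)

section Generators

variable {n r : ℕ} {F 𝒢 : Finset (Finset ℕ)} {A B G S : Finset ℕ}

lemma mem_uniformSets : A ∈ uniformSets n r ↔ A ⊆ Icc 1 n ∧ #A = r :=
  mem_powersetCard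

lemma mem_supersets : A ∈ supersets n r G ↔ A ∈ uniformSets n r ∧ G ⊆ A :=
  mem_filter

lemma supersets_subset_supersets (h : S ⊆ G) : supersets n r G ⊆ supersets n r S :=
  monotone_filter_right _ fun _ _ hG => h.trans hG

lemma mem_generated :
    A ∈ generated n r 𝒢 ↔ A ∈ uniformSets n r ∧ ∃ G ∈ 𝒢, G ⊆ A := by
  simp only [generated, mem_biUnion, mem_supersets]
  tauto

lemma insert_erase_mem_uniformSets {i j : ℕ} (hA : A ∈ uniformSets n r) (hj : j ∈ Icc 1 n)
    (hiA : i ∈ A) (hjA : j ∉ A) : insert j (A.erase i) ∈ uniformSets n r := by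
  rw [mem_uniformSets] at hA ⊢
  refine ⟨insert_subset hj ((erase_subset _ _).trans hA.1), ?_⟩
  rw [card_insert_of_notMem (mt mem_of_mem_erase hjA), card_erase_add_one hiA, hA.2]

lemma leftCompressed_iff :
    LeftCompressed n F ↔ ∀ i ∈ Icc 1 n, ∀ j ∈ Icc 1 n, j < i → ∀ A ∈ F, i ∈ A → j ∉ A →
      insert j (A.erase i) ∈ F := by
  have compress_eq {i j : ℕ} (hji : j < i) {A : Finset ℕ} (hi : i ∈ A) (hj : j ∉ A) :
      UV.compress {j} {i} A = insert j (A.erase i) := by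
    rw [UV.compress_of_disjoint_of_le (disjoint_singleton_left.2 hj) (singleton_subset_iff.2 hi)]
    grind
  refine forall₅_congr fun i _ j _ hji => ⟨fun h A hA hi hj => ?_, fun h => ?_⟩
  · rw [← compress_eq hji hi hj, ← h]
    exact UV.compress_mem_compression hA
  · have compress_mem : ∀ A ∈ F, UV.compress {j} {i} A ∈ F := fun A hA => by
      by_cases hc : Disjoint {j} A ∧ {i} ≤ A
      · have hj := disjoint_singleton_left.1 hc.1
        have hi := singleton_subset_iff.1 hc.2
        exact compress_eq hji hi hj ▸ h A hA hi hj
      · rwa [UV.compress, if_neg hc]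
    ext A
    rw [UV.mem_compression]
    refine ⟨?_, fun hA => Or.inl ⟨hA, compress_mem A hA⟩⟩
    rintro (hA | ⟨-, B, hB, rfl⟩)
    exacts [hA.1, compress_mem B hB]

lemma IsLCIF.shift_mem {i j : ℕ} (hF : IsLCIF n r F) (hA : A ∈ F) (hj : 1 ≤ j) (hji : j < i)
    (hiA : i ∈ A) (hjA : j ∉ A) : insert j (A.erase i) ∈ F := by
  have hi := (mem_uniformSets.1 (hF.1 hA)).1 hiA
  have hj : j ∈ Icc 1 n := mem_Icc.2 ⟨hj, hji.le.trans (mem_Icc.1 hi).2⟩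
  exact leftCompressed_iff.1 hF.2.1 i hi j hj hji A hA hiA hjA

lemma isLCIF_generated (hint : (𝒢 : Set (Finset ℕ)).Intersecting) (hshift : Shiftable 𝒢) :
    IsLCIF n r (generated n r 𝒢) := by
  refine ⟨fun A hA => (mem_generated.1 hA).1, leftCompressed_iff.2 ?_, ?_⟩
  · intro i _ j hj hji A hA hiA hjA
    obtain ⟨hA, G, hG, hGA⟩ := mem_generated.1 hA
    refine mem_generated.2 ⟨insert_erase_mem_uniformSets hA hj hiA hjA, ?_⟩
    by_cases hiG : i ∈ G
    · obtain ⟨G', hG', hsub⟩ := hshift G hG i hiG j (mem_Icc.1 hj).1 hji fun h => hjA (hGA h)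
      exact ⟨G', hG', hsub.trans (insert_subset_insert _ (erase_subset_erase _ hGA))⟩
    · exact ⟨G, hG, (subset_erase.2 ⟨hGA, hiG⟩).trans (subset_insert _ _)⟩
  · intro A hA B hB hAB
    obtain ⟨-, G, hG, hGA⟩ := mem_generated.1 hA
    obtain ⟨-, H, hH, hHB⟩ := mem_generated.1 hB
    exact hint hG hH (hAB.mono hGA hHB)

lemma exists_mem_supersets_disjoint (hn : 2 * r ≤ n) (hG : G ⊆ Icc 1 n) (hGr : #G ≤ r)
    (hAr : #A ≤ r) (hGA : Disjoint G A) : ∃ B ∈ supersets n r G, Disjoint B A := by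
  have hcard : r ≤ #(Icc 1 n \ A) := by
    have := le_card_sdiff A (Icc 1 n)
    rw [Nat.card_Icc] at this
    omega
  obtain ⟨B, hGB, hBA, hB⟩ := exists_subsuperset_card_eq (subset_sdiff.2 ⟨hG, hGA⟩) hGr hcard
  rw [subset_sdiff] at hBA
  exact ⟨B, mem_supersets.2 ⟨mem_uniformSets.2 ⟨hBA.1, hB⟩, hGB⟩, hBA.2⟩

lemma IsLCIF.not_disjoint_of_supersets_subset (hn : 2 * r ≤ n) (hF : IsLCIF n r F)
    (hG : G ⊆ Icc 1 n) (hGr : #G ≤ r) (hGF : supersets n r G ⊆ F) (hA : A ∈ F) :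
    ¬ Disjoint G A := by
  intro hGA
  obtain ⟨B, hB, hBA⟩ :=
    exists_mem_supersets_disjoint hn hG hGr (mem_uniformSets.1 (hF.1 hA)).2.le hGA
  exact hF.2.2 (hGF hB) hA hBA

lemma isMLCIF_generated (hn : 2 * r ≤ n) (hint : (𝒢 : Set (Finset ℕ)).Intersecting)
    (hshift : Shiftable 𝒢) (hsub : ∀ G ∈ 𝒢, G ⊆ Icc 1 n) (hcard : ∀ G ∈ 𝒢, #G ≤ r)
    (htrans : ∀ A, (∀ G ∈ 𝒢, ¬ Disjoint G A) → ∃ G ∈ 𝒢, G ⊆ A) :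
    IsMLCIF n r (generated n r 𝒢) := by
  refine ⟨isLCIF_generated hint hshift, fun F hF hle A hA => mem_generated.2 ⟨hF.1 hA, ?_⟩⟩
  refine htrans A fun G hG => ?_
  exact hF.not_disjoint_of_supersets_subset hn (hsub G hG) (hcard G hG)
    ((subset_biUnion_of_mem _ hG).trans hle) hA

lemma IsMLCIF.eq_generated (hG : IsMLCIF n r (generated n r 𝒢)) (hF : IsMLCIF n r F)
    (h : ∀ G ∈ 𝒢, supersets n r G ⊆ F) : F = generated n r 𝒢 :=
  (Maximal.eq_of_le hG hF.1 (biUnion_subset.2 h)).symm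

lemma IsLCIF.supersets_insert_subset {b c : ℕ} (hF : IsLCIF n r F) (hb : b ≤ n) (hc : 1 ≤ c)
    (hcb : c ≤ b) (hcS : c ∉ S) (h : supersets n r (insert b S) ⊆ F) :
    supersets n r (insert c S) ⊆ F := by
  intro A hA
  obtain ⟨hA, hSA⟩ := mem_supersets.1 hA
  rw [insert_subset_iff] at hSA
  by_cases hbA : b ∈ A
  · exact h (mem_supersets.2 ⟨hA, insert_subset hbA hSA.2⟩)
  · have hne : c ≠ b := by rintro rfl; exact hbA hSA.1
    have hshift : insert b (A.erase c) ∈ F := h <| mem_supersets.2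
      ⟨insert_erase_mem_uniformSets hA (mem_Icc.2 ⟨hc.trans hcb, hb⟩) hSA.1 hbA,
        insert_subset_insert _ (subset_erase.2 ⟨hSA.2, hcS⟩)⟩
    have := hF.shift_mem hshift hc (hcb.lt_of_ne hne) (mem_insert_self _ _) (by simp [hne])
    rwa [erase_insert (by simp [hbA]), insert_erase hSA.1] at this

lemma IsLCIF.supersets_pair_subset {a b a' b' : ℕ} (hF : IsLCIF n r F) (ha' : 1 ≤ a')
    (hab' : a' < b') (ha : a' ≤ a) (hb : b' ≤ b) (han : a ≤ n) (hbn : b ≤ n)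
    (h : supersets n r {a, b} ⊆ F) : supersets n r {a', b'} ⊆ F := by
  have h' : supersets n r {b, a'} ⊆ F := pair_comm a' b ▸
    hF.supersets_insert_subset han ha' ha (by simp; omega) h
  exact pair_comm a' b' ▸ hF.supersets_insert_subset hbn (by omega) hb (by simp; omega) h'

end Generators

section StarAndAHM

variable {n r t : ℕ} {A : Finset ℕ}

lemma mem_star1 : A ∈ star1 n r ↔ A ∈ uniformSets n r ∧ 1 ∈ A :=
  mem_filter

lemma mem_AHM : A ∈ AHM n r t ↔
    A ∈ uniformSets n r ∧ (1 ∈ A ∧ (A ∩ Icc 2 t).Nonempty ∨ Icc 2 t ⊆ A) := by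
  simp only [AHM, mem_star1, mem_union, mem_filter]
  tauto

/-- The minimal generating family of `AHM n r t`: the set `[2, t]` and the pairs `{1, x}` with
`x ∈ [2, t]`. -/
def ahmGenerators (t : ℕ) : Finset (Finset ℕ) :=
  insert (Icc 2 t) ((Icc 2 t).image fun x => {1, x})

lemma forall_mem_ahmGenerators {p : Finset ℕ → Prop} :
    (∀ G ∈ ahmGenerators t, p G) ↔ p (Icc 2 t) ∧ ∀ x ∈ Icc 2 t, p {1, x} := by
  simp only [ahmGenerators, forall_mem_insert, forall_mem_image]

lemma exists_mem_ahmGenerators {p : Finset ℕ → Prop} :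
    (∃ G ∈ ahmGenerators t, p G) ↔ p (Icc 2 t) ∨ ∃ x ∈ Icc 2 t, p {1, x} := by
  simp only [ahmGenerators, exists_mem_insert, exists_mem_image]

lemma star1_eq_generated : star1 n r = generated n r {{1}} := by
  ext A
  simp [mem_star1, mem_generated]

lemma AHM_eq_generated : AHM n r t = generated n r (ahmGenerators t) := by
  ext A
  simp only [mem_AHM, mem_generated, exists_mem_ahmGenerators, insert_subset_iff,
    singleton_subset_iff, Finset.Nonempty, mem_inter]
  grind

lemma isMLCIF_star1 (hr : 1 ≤ r) (hn : 2 * r ≤ n) : IsMLCIF n r (star1 n r) := by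
  rw [star1_eq_generated]
  refine isMLCIF_generated hn ?_ ?_ ?_ ?_ ?_
  · simp [Set.intersecting_singleton]
  · intro G hG i hi j hj hji
    rw [mem_singleton] at hG
    grind
  · grind
  · simpa using hr
  · simp

lemma shiftable_ahmGenerators (ht : 3 ≤ t) : Shiftable (ahmGenerators t) := by
  refine forall_mem_ahmGenerators.2 ⟨fun i hi j hj hji hjt => ?_, fun x hx i hi j hj hji hjx => ?_⟩
  · obtain ⟨x, hx, hxi⟩ : ∃ x ∈ Icc 2 t, x ≠ i := by
      by_cases h2 : i = 2
      · exact ⟨3, by simp [ht], by omega⟩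
      · exact ⟨2, by simp; omega, Ne.symm h2⟩
    have hj1 : j = 1 := by grind
    refine exists_mem_ahmGenerators.2 (Or.inr ⟨x, hx, ?_⟩)
    grind
  · refine exists_mem_ahmGenerators.2 (Or.inr ⟨j, ?_, ?_⟩) <;> grind

lemma isMLCIF_AHM (hn : 2 * r ≤ n) (ht : 3 ≤ t) (htr : t ≤ r + 1) : IsMLCIF n r (AHM n r t) := by
  have h2 : 2 ∈ Icc 2 t := mem_Icc.2 ⟨le_rfl, by omega⟩
  rw [AHM_eq_generated]
  refine isMLCIF_generated hn ?_ (shiftable_ahmGenerators ht) ?_ ?_ fun A hA => ?_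
  · refine forall_mem_ahmGenerators.2 ⟨?_, fun x hx => ?_⟩ <;>
      refine forall_mem_ahmGenerators.2 ⟨?_, fun y hy => ?_⟩ <;>
      rw [not_disjoint_iff]
    exacts [⟨2, h2, h2⟩, ⟨y, hy, by simp⟩, ⟨x, by simp, hx⟩, ⟨1, by simp, by simp⟩]
  · refine forall_mem_ahmGenerators.2 ⟨Icc_subset_Icc (by omega) (by omega), fun x hx => ?_⟩
    grind
  · refine forall_mem_ahmGenerators.2 ⟨by simp; omega, fun x _ => card_le_two.trans (by omega)⟩
  · rw [forall_mem_ahmGenerators, not_disjoint_iff] at hA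
    obtain ⟨⟨x, hx, hxA⟩, hpairs⟩ := hA
    refine exists_mem_ahmGenerators.2 ?_
    by_cases h1 : 1 ∈ A
    · exact Or.inr ⟨x, hx, by simp [insert_subset_iff, h1, hxA]⟩
    · exact Or.inl fun y hy => by simpa [h1] using hpairs y hy

end StarAndAHM

section Traces

variable {n r : ℕ} {F : Finset (Finset ℕ)} {A B : Finset ℕ}

lemma IsLCIF.inter_nonempty (hF : IsLCIF n r F) (hA : A ∈ F) (hB : B ∈ F) :
    (A ∩ B ∩ Icc 1 (2 * r)).Nonempty := by
  induction hk : #(A ∩ B) using Nat.strong_induction_on generalizing A with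
  | _ k ih =>
  by_contra hempty
  obtain ⟨c, hcA, hcB⟩ := not_disjoint_iff.1 (hF.2.2 hA hB)
  have hc : c ∉ Icc 1 (2 * r) := fun hc => hempty ⟨c, by simp only [mem_inter]; tauto⟩
  obtain ⟨j, hj, hjAB⟩ : ∃ j ∈ Icc 1 (2 * r), j ∉ A ∪ B := by
    by_contra! hcover
    have hle := card_le_card (insert_subset (mem_union_left B hcA) hcover)
    rw [card_insert_of_notMem hc, Nat.card_Icc] at hle
    have hAB := card_union_le A B
    rw [(mem_uniformSets.1 (hF.1 hA)).2, (mem_uniformSets.1 (hF.1 hB)).2] at hAB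
    omega
  rw [mem_union, not_or] at hjAB
  have hc1 : 1 ≤ c := (mem_Icc.1 ((mem_uniformSets.1 (hF.1 hA)).1 hcA)).1
  rw [mem_Icc] at hc hj
  have hinter : insert j (A.erase c) ∩ B = (A ∩ B).erase c := by
    rw [insert_inter_of_notMem hjAB.2, erase_inter]
  have hlt : #(insert j (A.erase c) ∩ B) < k := by
    rw [hinter, ← hk]
    exact card_erase_lt_of_mem (mem_inter.2 ⟨hcA, hcB⟩)
  have hshift := ih _ hlt (hF.shift_mem hA hj.1 (by omega) hcA hjAB.1) rfl
  rw [hinter] at hshift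
  exact hempty (hshift.mono (inter_subset_inter_right (erase_subset c _)))

lemma IsLCIF.shiftable_traces (hF : IsLCIF n r F) (m : ℕ) :
    Shiftable (F.image (· ∩ Icc 1 m)) := by
  refine forall_mem_image.2 fun B hB i hi j hj hji hjB => exists_mem_image.2 ?_
  rw [mem_inter, mem_Icc] at hi hjB
  refine ⟨_, hF.shift_mem hB hj hji hi.1 fun h => hjB ⟨h, by omega⟩, ?_⟩
  grind

lemma IsLCIF.intersecting_traces (hF : IsLCIF n r F) :
    (F.image (· ∩ Icc 1 (2 * r)) : Set (Finset ℕ)).Intersecting := by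
  rw [coe_image]
  rintro _ ⟨A, hA, rfl⟩ _ ⟨B, hB, rfl⟩
  rw [not_disjoint_iff_nonempty_inter, ← inter_inter_distrib_right]
  exact hF.inter_nonempty hA hB

lemma IsMLCIF.supersets_trace_subset (hF : IsMLCIF n r F) (hB : B ∈ F) :
    supersets n r (B ∩ Icc 1 (2 * r)) ⊆ F := by
  have hle : F ≤ generated n r (F.image (· ∩ Icc 1 (2 * r))) := fun A hA =>
    mem_generated.2 ⟨hF.1.1 hA, _, mem_image_of_mem _ hA, inter_subset_left⟩
  rw [hF.eq_of_le (isLCIF_generated hF.1.intersecting_traces (hF.1.shiftable_traces _)) hle]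
  exact subset_biUnion_of_mem _ (mem_image_of_mem _ hB)

end Traces

section Structure

variable {n r : ℕ} {F : Finset (Finset ℕ)} {A : Finset ℕ}

lemma IsMLCIF.eq_star1 (hr : 1 ≤ r) (hn : 2 * r ≤ n) (hF : IsMLCIF n r F)
    (h : supersets n r {1} ⊆ F) : F = star1 n r := by
  rw [star1_eq_generated]
  exact (star1_eq_generated (n := n) (r := r) ▸ isMLCIF_star1 hr hn).eq_generated hF (by simpa)

lemma IsMLCIF.eq_AHM {t : ℕ} (hn : 2 * r ≤ n) (ht : 3 ≤ t) (htr : t ≤ r + 1) (hF : IsMLCIF n r F)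
    (hIcc : supersets n r (Icc 2 t) ⊆ F) (hpair : ∀ x ∈ Icc 2 t, supersets n r {1, x} ⊆ F) :
    F = AHM n r t := by
  rw [AHM_eq_generated]
  exact (AHM_eq_generated (n := n) (r := r) ▸ isMLCIF_AHM hn ht htr).eq_generated hF
    (forall_mem_ahmGenerators.2 ⟨hIcc, hpair⟩)

lemma IsLCIF.Icc_two_subset {m : ℕ} (hr : 2 ≤ r) (hn : 2 * r ≤ n) (hm : m ≤ n)
    (hF : IsLCIF n r F) (h : supersets n r {1, m} ⊆ F) (hA : A ∈ F) (hA1 : 1 ∉ A) :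
    Icc 2 m ⊆ A := by
  intro x hx
  rw [mem_Icc] at hx
  have hxF : supersets n r {1, x} ⊆ F :=
    hF.supersets_pair_subset le_rfl (by omega) le_rfl hx.2 (by omega) hm h
  have hcover := hF.not_disjoint_of_supersets_subset hn (by grind) (card_le_two.trans hr) hxF hA
  simpa [hA1] using hcover

lemma IsMLCIF.exists_one_notMem (hr : 1 ≤ r) (hn : 2 * r ≤ n) (hF : IsMLCIF n r F)
    (hne : F ≠ star1 n r) : ∃ A ∈ F, 1 ∉ A := by
  by_contra! h
  exact hne (hF.eq_of_le (isMLCIF_star1 hr hn).1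
    fun A hA => mem_star1.2 ⟨hF.1.1 hA, h A hA⟩)

lemma IsMLCIF.le_of_supersets_pair_subset {m : ℕ} (hr : 2 ≤ r) (hn : 2 * r ≤ n) (hm : m ≤ n)
    (hF : IsMLCIF n r F) (hne : F ≠ star1 n r) (h : supersets n r {1, m} ⊆ F) : m ≤ r + 1 := by
  obtain ⟨A, hA, hA1⟩ := hF.exists_one_notMem (by omega) hn hne
  have hle := card_le_card (hF.1.Icc_two_subset hr hn hm h hA hA1)
  rw [Nat.card_Icc, (mem_uniformSets.1 (hF.1.1 hA)).2] at hle
  omega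

lemma IsMLCIF.eq_AHM_three {a b : ℕ} (hr : 2 ≤ r) (hn : 2 * r ≤ n) (hF : IsMLCIF n r F)
    (ha : 2 ≤ a) (hab : a < b) (hb : b ≤ n) (h : supersets n r {a, b} ⊆ F) : F = AHM n r 3 := by
  have hpair {a' b' : ℕ} (ha' : 1 ≤ a') (hab' : a' < b') (ha : a' ≤ 2) (hb' : b' ≤ 3) :
      supersets n r {a', b'} ⊆ F :=
    hF.1.supersets_pair_subset ha' hab' (by omega) (by omega) (by omega) hb h
  refine hF.eq_AHM hn le_rfl (by omega) ?_ fun x hx => ?_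
  · exact hpair (a' := 2) (b' := 3) (by simp) (by simp) le_rfl le_rfl
  · rw [mem_Icc] at hx
    exact hpair le_rfl (by omega) (by simp) hx.2

lemma mem_generated_powersetCard {k : ℕ} {S : Finset ℕ} :
    A ∈ generated n r (powersetCard k S) ↔ A ∈ uniformSets n r ∧ k ≤ #(A ∩ S) := by
  rw [mem_generated]
  refine and_congr_right fun _ => ⟨?_, fun h => ?_⟩
  · rintro ⟨G, hG, hGA⟩
    rw [mem_powersetCard] at hG
    exact hG.2 ▸ card_le_card (subset_inter hGA hG.1)
  · obtain ⟨G, hG, hGk⟩ := exists_subset_card_eq h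
    exact ⟨G, mem_powersetCard.2 ⟨hG.trans inter_subset_right, hGk⟩,
      hG.trans inter_subset_left⟩

lemma IsMLCIF.mem_generated_of_one_notMem (hr : 2 ≤ r) (hn : 2 * r ≤ n) (hF : IsMLCIF n r F)
    (hAHM : F ≠ AHM n r 3) (hA : A ∈ F) (hA1 : 1 ∉ A) :
    A ∈ generated n r (powersetCard 3 (Icc 1 (2 * r))) := by
  refine mem_generated_powersetCard.2 ⟨hF.1.1 hA, not_lt.1 fun hlight => ?_⟩
  have hsub := hF.supersets_trace_subset hA
  have hpos : (A ∩ Icc 1 (2 * r)).Nonempty := by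
    simpa only [inter_self] using hF.1.inter_nonempty hA hA
  have hrange : ∀ x ∈ A ∩ Icc 1 (2 * r), 2 ≤ x ∧ x ≤ n := by grind
  generalize A ∩ Icc 1 (2 * r) = T at *
  obtain hT | hT : #T = 1 ∨ #T = 2 := by have := hpos.card_pos; omega
  · obtain ⟨a, rfl⟩ := card_eq_one.1 hT
    have ha := hrange a (mem_singleton_self a)
    have hstar := hF.eq_star1 (by omega) hn
      (hF.1.supersets_insert_subset (S := ∅) ha.2 le_rfl (by omega) (by simp) hsub)
    exact hA1 (mem_star1.1 (hstar ▸ hA)).2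
  · obtain ⟨a, b, hab, rfl⟩ : ∃ a b, a < b ∧ T = {a, b} := by
      obtain ⟨a, b, hne, rfl⟩ := card_eq_two.1 hT
      rcases hne.lt_or_gt with h | h
      exacts [⟨a, b, h, rfl⟩, ⟨b, a, h, pair_comm a b⟩]
    have ha := hrange a (mem_insert_self a {b})
    have hb := hrange b (mem_insert_of_mem (mem_singleton_self b))
    exact hAHM (hF.eq_AHM_three hr hn ha.1 hab hb.2 hsub)

end Structure

section Counting

variable {n r : ℕ} {F H 𝒢 : Finset (Finset ℕ)} {A G S T X : Finset ℕ}

/-- The family of all `r`-subsets of `[n]` whose trace on `S` is `T`. -/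
def traceClass (n r : ℕ) (S T : Finset ℕ) : Finset (Finset ℕ) :=
  {A ∈ uniformSets n r | A ∩ S = T}

lemma mem_traceClass : A ∈ traceClass n r S T ↔ A ∈ uniformSets n r ∧ A ∩ S = T :=
  mem_filter

lemma card_traceClass (hS : S ⊆ Icc 1 n) (hT : T ⊆ S) (hTr : #T ≤ r) :
    #(traceClass n r S T) = (n - #S).choose (r - #T) := by
  have disjoint_of_mem {B : Finset ℕ} (hB : B ∈ powersetCard (r - #T) (Icc 1 n \ S)) :
      Disjoint B S := (subset_sdiff.1 (mem_powersetCard.1 hB).1).2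
  have himage : traceClass n r S T = (powersetCard (r - #T) (Icc 1 n \ S)).image (· ∪ T) := by
    ext A
    rw [mem_traceClass, mem_uniformSets, mem_image]
    constructor
    · rintro ⟨⟨hA, rfl⟩, rfl⟩
      refine ⟨A \ S, mem_powersetCard.2 ⟨sdiff_subset_sdiff hA subset_rfl, ?_⟩, ?_⟩
      · rw [card_sdiff, inter_comm]
      · exact sdiff_union_inter A S
    · rintro ⟨B, hB, rfl⟩
      have hBS := disjoint_of_mem hB
      rw [mem_powersetCard] at hB
      refine ⟨⟨union_subset (hB.1.trans sdiff_subset) (hT.trans hS), ?_⟩, ?_⟩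
      · rw [card_union_of_disjoint (hBS.mono_right hT), hB.2, Nat.sub_add_cancel hTr]
      · rw [union_inter_distrib_right, disjoint_iff_inter_eq_empty.1 hBS, empty_union,
          inter_eq_left.2 hT]
  rw [himage, card_image_of_injOn, card_powersetCard, card_sdiff_of_subset hS, Nat.card_Icc,
    Nat.add_sub_cancel]
  intro B hB C hC (hBC : B ∪ T = C ∪ T)
  rw [← union_sdiff_cancel_right ((disjoint_of_mem hB).mono_right hT), hBC,
    union_sdiff_cancel_right ((disjoint_of_mem hC).mono_right hT)]

lemma card_supersets (hG : G ⊆ Icc 1 n) (hGr : #G ≤ r) :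
    #(supersets n r G) = (n - #G).choose (r - #G) := by
  rw [← card_traceClass hG subset_rfl hGr]
  simp only [supersets, traceClass, inter_eq_right]

lemma card_generated_powersetCard_le {k : ℕ} (hS : S ⊆ Icc 1 n) (hk : k ≤ r) :
    #(generated n r (powersetCard k S)) ≤ (#S).choose k * (n - k).choose (r - k) := by
  rw [← card_powersetCard k S]
  refine card_biUnion_le_card_mul _ _ _ fun G hG => ?_
  rw [mem_powersetCard] at hG
  rw [card_supersets (hG.1.trans hS) (hG.2.trans_le hk), hG.2]

lemma hit_add_hit_sdiff_comm : hit X F + hit X (H \ F) = hit X H + hit X (F \ H) := by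
  have hsdiff (F H : Finset (Finset ℕ)) : hit X (F \ H) = #({A ∈ F | (A ∩ X).Nonempty} \
      {A ∈ H | (A ∩ X).Nonempty}) := by rw [hit]; congr 1; grind
  rw [hsdiff, hsdiff, hit, hit, add_comm, card_sdiff_add_card, add_comm, card_sdiff_add_card,
    union_comm]

lemma hit_mono (h : F ⊆ H) : hit X F ≤ hit X H :=
  card_le_card (filter_subset_filter _ h)

lemma hit_traceClass_of_inter_nonempty (hTX : (T ∩ X).Nonempty) :
    hit X (traceClass n r S T) = #(traceClass n r S T) := by
  rw [hit, filter_true_of_mem]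
  intro A hA
  obtain ⟨-, rfl⟩ := mem_traceClass.1 hA
  exact hTX.mono (inter_subset_inter_right inter_subset_left)

lemma hit_traceClass_add_card (hTX : Disjoint T X) :
    hit X (traceClass n r S T) + #(traceClass n r (S ∪ X) T) = #(traceClass n r S T) := by
  rw [hit, ← card_filter_add_card_filter_not (s := traceClass n r S T) (fun A => (A ∩ X).Nonempty)]
  congr 2
  ext A
  rw [mem_filter, mem_traceClass, mem_traceClass, not_nonempty_iff_eq_empty, and_assoc,
    inter_union_distrib_left]
  refine and_congr_right fun _ => ⟨?_, fun h => by rw [h.1, h.2, union_empty]⟩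
  rintro rfl
  have hAX : A ∩ X = ∅ := (hTX.mono_left subset_union_right).eq_bot_of_le inter_subset_right
  rw [hAX, union_empty]
  exact ⟨rfl, rfl⟩

lemma hit_traceClass_add_choose (hS : S ⊆ Icc 1 n) (hX : X ⊆ Icc 1 n) (hTS : T ⊆ S) (hTr : #T ≤ r)
    (hTX : Disjoint T X) :
    hit X (traceClass n r S T) + (n - #(S ∪ X)).choose (r - #T) = (n - #S).choose (r - #T) := by
  rw [← card_traceClass hS hTS hTr, ← hit_traceClass_add_card hTX,
    card_traceClass (union_subset hS hX) (hTS.trans subset_union_left) hTr]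

end Counting

section Large

open Filter Asymptotics

/-- `n` is large enough in terms of `r ≥ 3` for the `r`-subsets of `[n]` with a prescribed trace of
size `2` on a set of size at most `2r + 1` to outnumber those that have at least three elements in
`[2r]`. -/
structure IsLarge (n r : ℕ) : Prop where
  three_le : 3 ≤ r
  two_mul_lt : 2 * r < n
  choose_lt : (2 * r).choose 3 * (n - 3).choose (r - 3) < (n - (2 * r + 1)).choose (r - 2)

lemma eventually_mul_choose_lt_choose_sub (b c k : ℕ) :
    ∀ᶠ n in atTop, c * n.choose k < (n - b).choose (k + 1) := by
  have hid : (fun n : ℕ => (n : ℝ)) =O[atTop] fun n => ((n - b : ℕ) : ℝ) := by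
    refine IsBigO.of_bound 2 ?_
    filter_upwards [eventually_ge_atTop (2 * b)] with n hn
    simp only [Real.norm_natCast]
    norm_cast
    omega
  have ho : (fun n : ℕ => (n.choose k : ℝ)) =o[atTop] fun n => ((n - b).choose (k + 1) : ℝ) :=
    calc (fun n : ℕ => (n.choose k : ℝ))
      _ =Θ[atTop] fun n => (n : ℝ) ^ k := isTheta_choose k
      _ =o[atTop] fun n => (n : ℝ) ^ (k + 1) :=
        (isLittleO_pow_pow_atTop_of_lt k.lt_succ_self).comp_tendsto tendsto_natCast_atTop_atTop
      _ =O[atTop] fun n => ((n - b : ℕ) : ℝ) ^ (k + 1) := hid.pow _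
      _ =O[atTop] fun n => ((n - b).choose (k + 1) : ℝ) :=
        (isTheta_choose (k + 1)).symm.isBigO.comp_tendsto (tendsto_sub_atTop_nat b)
  filter_upwards [ho.bound (c := ((c + 1 : ℕ) : ℝ)⁻¹) (by positivity), eventually_ge_atTop k]
    with n hn hkn
  rw [Real.norm_natCast, Real.norm_natCast, le_inv_mul_iff₀ (by positivity)] at hn
  have hn : (c + 1) * n.choose k ≤ (n - b).choose (k + 1) := by exact_mod_cast hn
  have := Nat.choose_pos hkn
  linarith

lemma exists_forall_isLarge {r : ℕ} (hr : 3 ≤ r) : ∃ N, ∀ n, N ≤ n → IsLarge n r := by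
  refine eventually_atTop.1 ?_
  filter_upwards [eventually_gt_atTop (2 * r),
    eventually_mul_choose_lt_choose_sub (2 * r + 1) ((2 * r).choose 3) (r - 3)] with n hn hlt
  refine ⟨hr, hn, (Nat.mul_le_mul_left _ (Nat.choose_le_choose _ (n.sub_le 3))).trans_lt ?_⟩
  rwa [show r - 3 + 1 = r - 2 by omega] at hlt

end Large

section Comparison

variable {n r : ℕ} {F H : Finset (Finset ℕ)} {S T X : Finset ℕ}

lemma IsLarge.choose_sub_four_lt (h : IsLarge n r) :
    (n - 4).choose (r - 3) < (n - 5).choose (r - 2) := by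
  have hr := h.three_le
  calc (n - 4).choose (r - 3)
    _ ≤ (n - 3).choose (r - 3) := Nat.choose_le_choose _ (by omega)
    _ ≤ (2 * r).choose 3 * (n - 3).choose (r - 3) :=
      Nat.le_mul_of_pos_left _ (Nat.choose_pos (by omega))
    _ < (n - (2 * r + 1)).choose (r - 2) := h.choose_lt
    _ ≤ (n - 5).choose (r - 2) := Nat.choose_le_choose _ (by omega)

lemma hit_lt_hit_iff_sdiff : hit X F < hit X H ↔ hit X (F \ H) < hit X (H \ F) := by
  have := hit_add_hit_sdiff_comm (F := F) (H := H) (X := X)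
  omega

lemma IsLarge.hit_lt_hit_of_trace (h : IsLarge n r) (hS : S ⊆ Icc 1 n) (hSr : #S ≤ 2 * r + 1)
    (hTS : T ⊆ S) (hT : #T = 2) (hTX : (T ∩ X).Nonempty)
    (hHF : traceClass n r S T ⊆ H \ F)
    (hFH : ∀ A ∈ F \ H, (A ∩ X).Nonempty → A ∈ generated n r (powersetCard 3 (Icc 1 (2 * r)))) :
    hit X F < hit X H := by
  have hr := h.three_le
  rw [hit_lt_hit_iff_sdiff]
  calc hit X (F \ H)
    _ ≤ #(generated n r (powersetCard 3 (Icc 1 (2 * r)))) :=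
      card_le_card fun A hA => hFH A (mem_filter.1 hA).1 (mem_filter.1 hA).2
    _ ≤ (2 * r).choose 3 * (n - 3).choose (r - 3) := by
      simpa using card_generated_powersetCard_le (Icc_subset_Icc_right h.two_mul_lt.le) hr
    _ < (n - (2 * r + 1)).choose (r - 2) := h.choose_lt
    _ ≤ (n - #S).choose (r - #T) := hT.symm ▸ Nat.choose_le_choose _ (by omega)
    _ = #(traceClass n r S T) := (card_traceClass hS hTS (by omega)).symm
    _ = hit X (traceClass n r S T) := (hit_traceClass_of_inter_nonempty hTX).symm
    _ ≤ hit X (H \ F) := hit_mono hHF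

lemma IsMLCIF.hit_lt_hit_star1 {y : ℕ} (h : IsLarge n r) (hF : IsMLCIF n r F)
    (hAHM : F ≠ AHM n r 3) (hy : y ∈ X) (hy2 : 2 ≤ y) (hyn : y ≤ n)
    (hyF : ¬ supersets n r {1, y} ⊆ F) : hit X F < hit X (star1 n r) := by
  have hr := h.three_le
  have hn := h.two_mul_lt
  refine h.hit_lt_hit_of_trace (S := insert y (Icc 1 (2 * r))) (T := {1, y}) ?_ ?_ ?_ ?_ ?_ ?_ ?_
  · exact insert_subset (by simp; omega) (Icc_subset_Icc_right hn.le)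
  · simpa using card_insert_le y (Icc 1 (2 * r))
  · grind
  · exact card_pair (by omega)
  · exact ⟨y, by simp [hy]⟩
  · intro A hA
    obtain ⟨hA, htrace⟩ := mem_traceClass.1 hA
    refine mem_sdiff.2 ⟨mem_star1.2 ⟨hA, ?_⟩, fun hAF => hyF ?_⟩
    · exact (htrace.ge.trans inter_subset_left) (by simp)
    · refine Subset.trans ?_ (hF.supersets_trace_subset hAF)
      exact supersets_subset_supersets
        (htrace ▸ inter_subset_inter_left (subset_insert y (Icc 1 (2 * r))))
  · intro A hA _
    obtain ⟨hA, hAstar⟩ := mem_sdiff.1 hA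
    exact hF.mem_generated_of_one_notMem (by omega) hn.le hAHM hA
      fun h1 => hAstar (mem_star1.2 ⟨hF.1.1 hA, h1⟩)

lemma IsMLCIF.hit_lt_hit_star1_of_not_subset (h : IsLarge n r) (hF : IsMLCIF n r F)
    (hstar : F ≠ star1 n r) (hAHM : F ≠ AHM n r 3) (hX : X ⊆ Icc 2 n)
    (hXr : ¬ X ⊆ Icc 2 (r + 1)) : hit X F < hit X (star1 n r) := by
  have hr := h.three_le
  obtain ⟨y, hy, hyr⟩ := not_subset.1 hXr
  obtain ⟨hy2, hyn⟩ := mem_Icc.1 (hX hy)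
  refine hF.hit_lt_hit_star1 h hAHM hy hy2 hyn fun hsub => hyr (mem_Icc.2 ⟨hy2, ?_⟩)
  exact hF.le_of_supersets_pair_subset (by omega) h.two_mul_lt.le hyn hstar hsub

lemma IsMLCIF.hit_singleton_two_lt_hit_AHM_three (h : IsLarge n r) (hF : IsMLCIF n r F)
    (hAHM : F ≠ AHM n r 3) : hit {2} F < hit {2} (AHM n r 3) := by
  have hr := h.three_le
  have hn := h.two_mul_lt
  refine h.hit_lt_hit_of_trace (S := Icc 1 (2 * r)) (T := {2, 3}) ?_ ?_ ?_ rfl ⟨2, by simp⟩ ?_ ?_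
  · exact Icc_subset_Icc_right hn.le
  · simp
  · grind
  · intro A hA
    obtain ⟨hA, htrace⟩ := mem_traceClass.1 hA
    refine mem_sdiff.2 ⟨mem_AHM.2 ⟨hA, Or.inr ?_⟩, fun hAF => hAHM ?_⟩
    · exact htrace.ge.trans inter_subset_left
    · exact hF.eq_AHM_three (a := 2) (b := 3) (by omega) hn.le le_rfl (by simp) (by omega)
        (htrace ▸ hF.supersets_trace_subset hAF)
  · intro A hA hA2
    obtain ⟨hA, hAnot⟩ := mem_sdiff.1 hA
    refine hF.mem_generated_of_one_notMem (by omega) hn.le hAHM hA fun h1 => hAnot ?_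
    exact mem_AHM.2 ⟨hF.1.1 hA, Or.inl ⟨h1, hA2.mono (inter_subset_inter_left (by simp))⟩⟩

lemma IsMLCIF.hit_lt_hit_AHM_of_supersets_pair_subset {m : ℕ} (hn : 2 * r ≤ n) (hm : 3 ≤ m)
    (hmr : m ≤ r + 1) (hF : IsMLCIF n r F) (hne : F ≠ AHM n r m) (hX : X ⊆ Icc 2 m)
    (hX0 : X.Nonempty) (hpair : supersets n r {1, m} ⊆ F) : hit X F < hit X (AHM n r m) := by
  have hhit : {A ∈ F | (A ∩ X).Nonempty} ⊆ {A ∈ AHM n r m | (A ∩ X).Nonempty} := by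
    intro A hA
    obtain ⟨hA, hAX⟩ := mem_filter.1 hA
    refine mem_filter.2 ⟨mem_AHM.2 ⟨hF.1.1 hA, ?_⟩, hAX⟩
    by_cases h1 : 1 ∈ A
    · exact Or.inl ⟨h1, hAX.mono (inter_subset_inter_left hX)⟩
    · exact Or.inr (hF.1.Icc_two_subset (by omega) hn (by omega) hpair hA h1)
  obtain ⟨A, hA, hAF⟩ : ∃ A ∈ supersets n r (Icc 2 m), A ∉ F := by
    by_contra! hIcc
    refine hne (hF.eq_AHM hn hm hmr hIcc fun x hx => ?_)
    rw [mem_Icc] at hx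
    exact hF.1.supersets_pair_subset le_rfl (by omega) le_rfl hx.2 (by omega) (by omega) hpair
  have hAX : (A ∩ X).Nonempty :=
    hX0.mono (subset_inter (hX.trans (mem_supersets.1 hA).2) subset_rfl)
  refine card_lt_card ⟨hhit, fun hle => hAF ?_⟩
  have hAHM : A ∈ AHM n r m := mem_AHM.2 ((mem_supersets.1 hA).imp_right Or.inr)
  exact (mem_filter.1 (hle (mem_filter.2 ⟨hAHM, hAX⟩))).1

end Comparison

section AHMVersusStar

variable {n r t : ℕ} {S T X : Finset ℕ}

lemma AHM_sdiff_star1 (ht : 1 ≤ t) :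
    AHM n r t \ star1 n r = traceClass n r (Icc 1 t) (Icc 2 t) := by
  ext A
  simp only [mem_sdiff, mem_AHM, mem_star1, mem_traceClass]
  have : A ∩ Icc 1 t = Icc 2 t ↔ 1 ∉ A ∧ Icc 2 t ⊆ A := by
    rw [← insert_Icc_add_one_left_eq_Icc ht]
    grind
  tauto

lemma star1_sdiff_AHM (ht : 2 ≤ t) :
    star1 n r \ AHM n r t = traceClass n r (Icc 1 t) {1} := by
  ext A
  simp only [mem_sdiff, mem_AHM, mem_star1, mem_traceClass]
  have : A ∩ Icc 1 t = {1} ↔ 1 ∈ A ∧ ¬ (A ∩ Icc 2 t).Nonempty := by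
    simp only [not_nonempty_iff_eq_empty, Finset.ext_iff, mem_inter, mem_Icc, mem_singleton,
      notMem_empty]
    grind
  have hmeet (h : Icc 2 t ⊆ A) : (A ∩ Icc 2 t).Nonempty := by
    rwa [inter_eq_right.2 h, nonempty_Icc]
  tauto

lemma hit_star1_add_eq_hit_AHM_add (ht : 2 ≤ t) :
    hit X (star1 n r) + hit X (traceClass n r (Icc 1 t) (Icc 2 t)) =
      hit X (AHM n r t) + hit X (traceClass n r (Icc 1 t) {1}) := by
  rw [← AHM_sdiff_star1 (by omega), ← star1_sdiff_AHM ht, hit_add_hit_sdiff_comm]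

lemma card_Icc_one_union (hX : X ⊆ Icc 2 n) : #(Icc 1 t ∪ X) = t + #(X \ Icc 2 t) := by
  have hsdiff : X \ Icc 1 t = X \ Icc 2 t := by grind
  rw [← union_sdiff_self_eq_union, card_union_of_disjoint disjoint_sdiff, Nat.card_Icc, hsdiff,
    Nat.add_sub_cancel]

lemma hit_traceClass_one_add (hr : 1 ≤ r) (ht : 1 ≤ t) (htn : t ≤ n) (hX : X ⊆ Icc 2 n) :
    hit X (traceClass n r (Icc 1 t) {1}) + (n - (t + #(X \ Icc 2 t))).choose (r - 1) =
      (n - t).choose (r - 1) := by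
  have h1 : 1 ∉ X := by grind
  have hXn : X ⊆ Icc 1 n := hX.trans (Icc_subset_Icc_left one_le_two)
  simpa [card_Icc_one_union hX] using hit_traceClass_add_choose (T := {1})
    (Icc_subset_Icc_right htn) hXn (by simpa) (by simpa) (by simpa)

lemma hit_traceClass_Icc_two (ht : 1 ≤ t) (htr : t ≤ r + 1) (htn : t ≤ n)
    (hX : (X ∩ Icc 2 t).Nonempty) :
    hit X (traceClass n r (Icc 1 t) (Icc 2 t)) = (n - t).choose (r + 1 - t) := by
  rw [hit_traceClass_of_inter_nonempty (inter_comm X _ ▸ hX), card_traceClass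
    (Icc_subset_Icc_right htn) (Icc_subset_Icc_left one_le_two) (by rw [Nat.card_Icc]; omega),
    Nat.card_Icc, Nat.card_Icc]
  congr 1; omega

lemma hit_AHM_of_subset {m : ℕ} (hm : 2 ≤ m) (hmr : m ≤ r + 1) (hmn : m ≤ n) (hX : X ⊆ Icc 2 m)
    (hX0 : X.Nonempty) :
    hit X (AHM n r m) = hit X (star1 n r) + (n - m).choose (r + 1 - m) := by
  have hXn : X ⊆ Icc 2 n := hX.trans (Icc_subset_Icc_right hmn)
  have hloss := hit_traceClass_one_add (r := r) (by omega) (by omega) hmn hXn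
  rw [sdiff_eq_empty_iff_subset.2 hX, card_empty, add_zero] at hloss
  have hgain := hit_traceClass_Icc_two (r := r) (n := n) (by omega) hmr hmn
    (by rwa [inter_eq_left.2 hX])
  have := hit_star1_add_eq_hit_AHM_add (n := n) (r := r) (X := X) hm
  omega

lemma hit_star1_le_hit_AHM {m : ℕ} (hm : 2 ≤ m) (hmr : m ≤ r + 1) (hmn : m ≤ n)
    (hX : X ⊆ Icc 2 m) (hX0 : X.Nonempty) : hit X (star1 n r) ≤ hit X (AHM n r m) :=
  (hit_AHM_of_subset hm hmr hmn hX hX0).symm ▸ Nat.le_add_right _ _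

end AHMVersusStar

section AHMThree

/-- Either `X` consists of one element of `{2, 3}` and one element outside, or it consists of `2`,
`3` and one further element. For such sets `AHM n r 3` is optimal. -/
def IsExceptional (X : Finset ℕ) : Prop :=
  (X ∩ {2, 3}).Nonempty ∧ #(X \ {2, 3}) = 1

variable {n r m : ℕ} {X : Finset ℕ}

lemma hit_traceClass_one_of_card_eq_one (hr : 3 ≤ r) (hn : 4 ≤ n) (hX : X ⊆ Icc 2 n)
    (hcard : #(X \ {2, 3}) = 1) :
    hit X (traceClass n r (Icc 1 3) {1}) = (n - 4).choose (r - 2) := by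
  have hloss : hit X (traceClass n r (Icc 1 3) {1}) + (n - 4).choose (r - 1) =
      (n - 3).choose (r - 1) := by
    have := hit_traceClass_one_add (r := r) (t := 3) (by omega) (by omega) (by omega) hX
    rwa [show Icc 2 3 = {2, 3} from rfl, hcard] at this
  have hpascal : (n - 3).choose (r - 1) = (n - 4).choose (r - 2) + (n - 4).choose (r - 1) :=
    Nat.choose_eq_choose_pred_add (by omega) (by omega)
  omega

lemma IsExceptional.hit_AHM_three (h : IsExceptional X) (hr : 3 ≤ r) (hn : 4 ≤ n)
    (hX : X ⊆ Icc 2 n) :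
    hit X (AHM n r 3) = hit X (star1 n r) + (n - 4).choose (r - 3) := by
  have hgain : hit X (traceClass n r (Icc 1 3) (Icc 2 3)) = (n - 3).choose (r - 2) :=
    hit_traceClass_Icc_two (by omega) (by omega) (by omega) h.1
  have hloss : hit X (traceClass n r (Icc 1 3) {1}) = (n - 4).choose (r - 2) :=
    hit_traceClass_one_of_card_eq_one hr hn hX h.2
  have hpascal : (n - 3).choose (r - 2) = (n - 4).choose (r - 3) + (n - 4).choose (r - 2) :=
    Nat.choose_eq_choose_pred_add (by omega) (by omega)
  have := hit_star1_add_eq_hit_AHM_add (n := n) (r := r) (t := 3) (X := X) (by omega)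
  omega

lemma IsLarge.hit_AHM_three_lt_hit_star1_of_disjoint (h : IsLarge n r) (hX : X ⊆ Icc 2 n)
    (hdisj : Disjoint X {2, 3}) (hcard : #(X \ {2, 3}) = 1) :
    hit X (AHM n r 3) < hit X (star1 n r) := by
  have hr := h.three_le
  have hrn := h.two_mul_lt
  have hgain : hit X (traceClass n r (Icc 1 3) (Icc 2 3)) + (n - 4).choose (r - 2) =
      (n - 3).choose (r - 2) := by
    have := hit_traceClass_add_choose (n := n) (r := r) (S := Icc 1 3) (T := Icc 2 3)
      (Icc_subset_Icc_right (by omega)) (hX.trans (Icc_subset_Icc_left one_le_two))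
      (Icc_subset_Icc_left one_le_two) (by simp; omega) hdisj.symm
    rwa [card_Icc_one_union hX, show Icc 2 3 = {2, 3} from rfl, hcard] at this
  have hpascal : (n - 3).choose (r - 2) = (n - 4).choose (r - 3) + (n - 4).choose (r - 2) :=
    Nat.choose_eq_choose_pred_add (by omega) (by omega)
  rw [hit_lt_hit_iff_sdiff, AHM_sdiff_star1 (by omega), star1_sdiff_AHM (by omega)]
  calc hit X (traceClass n r (Icc 1 3) (Icc 2 3))
    _ = (n - 4).choose (r - 3) := by omega
    _ < (n - 5).choose (r - 2) := h.choose_sub_four_lt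
    _ ≤ (n - 4).choose (r - 2) := Nat.choose_le_choose _ (by omega)
    _ = hit X (traceClass n r (Icc 1 3) {1}) :=
      (hit_traceClass_one_of_card_eq_one hr (by omega) hX hcard).symm

lemma IsLarge.hit_AHM_three_lt_hit_star1_of_one_lt_card (h : IsLarge n r) (hX : X ⊆ Icc 2 n)
    (hcard : 1 < #(X \ {2, 3})) : hit X (AHM n r 3) < hit X (star1 n r) := by
  have hr := h.three_le
  have hrn := h.two_mul_lt
  have hlt := h.choose_sub_four_lt
  have hloss : hit X (traceClass n r (Icc 1 3) {1}) + (n - (3 + #(X \ {2, 3}))).choose (r - 1) =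
      (n - 3).choose (r - 1) :=
    hit_traceClass_one_add (by omega) (by omega) (by omega) hX
  have hmono : (n - (3 + #(X \ {2, 3}))).choose (r - 1) ≤ (n - 5).choose (r - 1) :=
    Nat.choose_le_choose _ (by omega)
  have hpascal₁ : (n - 3).choose (r - 2) = (n - 4).choose (r - 3) + (n - 4).choose (r - 2) :=
    Nat.choose_eq_choose_pred_add (by omega) (by omega)
  have hpascal₂ : (n - 3).choose (r - 1) = (n - 4).choose (r - 2) + (n - 4).choose (r - 1) :=
    Nat.choose_eq_choose_pred_add (by omega) (by omega)
  have hpascal₃ : (n - 4).choose (r - 1) = (n - 5).choose (r - 2) + (n - 5).choose (r - 1) :=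
    Nat.choose_eq_choose_pred_add (by omega) (by omega)
  rw [hit_lt_hit_iff_sdiff, AHM_sdiff_star1 (by omega), star1_sdiff_AHM (by omega)]
  calc hit X (traceClass n r (Icc 1 3) (Icc 2 3))
    _ ≤ #(traceClass n r (Icc 1 3) (Icc 2 3)) := card_filter_le _ _
    _ = (n - 3).choose (r - 2) := card_traceClass (Icc_subset_Icc_right (by omega))
      (Icc_subset_Icc_left one_le_two) (by simp; omega)
    _ < hit X (traceClass n r (Icc 1 3) {1}) := by omega

lemma IsLarge.hit_AHM_three_lt_hit_star1 (h : IsLarge n r) (hX : X ⊆ Icc 2 n)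
    (hX3 : ¬ X ⊆ {2, 3}) (hexc : ¬ IsExceptional X) :
    hit X (AHM n r 3) < hit X (star1 n r) := by
  have hpos : 1 ≤ #(X \ {2, 3}) := card_pos.2 (sdiff_nonempty.2 hX3)
  obtain hcard | hcard := hpos.eq_or_lt
  · refine h.hit_AHM_three_lt_hit_star1_of_disjoint hX ?_ hcard.symm
    rw [disjoint_iff_inter_eq_empty, ← not_nonempty_iff_eq_empty]
    exact fun hmeet => hexc ⟨hmeet, hcard.symm⟩
  · exact h.hit_AHM_three_lt_hit_star1_of_one_lt_card hX hcard

lemma choose_sub_sub_lt {a b k : ℕ} (hk : 0 < k) (hkb : k ≤ b) (hba : b < a) :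
    (a - k).choose (b - k) < a.choose b := by
  have hpred : (a - 1).choose (b - 1) < a.choose b := by
    have := Nat.choose_pos (show b ≤ a - 1 by omega)
    rw [Nat.choose_eq_choose_pred_add (n := a) (by omega) (by omega)]
    omega
  calc (a - k).choose (b - k)
    _ = (a - k).choose (a - b) := Nat.choose_symm_of_eq_add (by omega)
    _ ≤ (a - 1).choose (a - b) := Nat.choose_le_choose _ (by omega)
    _ = (a - 1).choose (b - 1) := Nat.choose_symm_of_eq_add (by omega)
    _ < a.choose b := hpred

lemma IsExceptional.nonempty (h : IsExceptional X) : X.Nonempty :=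
  h.1.mono inter_subset_left

lemma IsExceptional.exists_four_le (h : IsExceptional X) (hX : X ⊆ Icc 2 n) :
    ∃ m ∈ X, 4 ≤ m := by
  obtain ⟨m, hm⟩ : (X \ {2, 3}).Nonempty := card_pos.1 (h.2 ▸ one_pos)
  rw [mem_sdiff, mem_insert, mem_singleton] at hm
  have := (mem_Icc.1 (hX hm.1)).1
  exact ⟨m, hm.1, by omega⟩

lemma IsExceptional.subset_Icc (h : IsExceptional X) (hX : X ⊆ Icc 2 n) (hmX : m ∈ X)
    (hm : 4 ≤ m) : X ⊆ Icc 2 m := by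
  intro x hx
  by_contra hxm
  have hx2 : 2 ≤ x := (mem_Icc.1 (hX hx)).1
  have hx3 : x ∈ X \ {2, 3} := by grind
  have hm3 : m ∈ X \ {2, 3} := by grind
  have hxm : x = m := card_le_one.1 h.2.le x hx3 m hm3
  grind

lemma IsExceptional.hit_AHM_lt_hit_AHM_three (h : IsExceptional X) (hm : 4 < m) (hmr : m ≤ r + 1)
    (hn : r + 1 < n) (hX : X ⊆ Icc 2 m) : hit X (AHM n r m) < hit X (AHM n r 3) := by
  rw [hit_AHM_of_subset (by omega) hmr (by omega) hX h.nonempty,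
    h.hit_AHM_three (by omega) (by omega) (hX.trans (Icc_subset_Icc_right (by omega)))]
  have := choose_sub_sub_lt (a := n - 4) (b := r - 3) (k := m - 4) (by omega) (by omega) (by omega)
  rwa [show n - 4 - (m - 4) = n - m by omega, show r - 3 - (m - 4) = r + 1 - m by omega,
    ← Nat.add_lt_add_iff_left] at this

lemma IsExceptional.hit_AHM_four (h : IsExceptional X) (hr : 3 ≤ r) (hn : 4 ≤ n)
    (hX : X ⊆ Icc 2 4) : hit X (AHM n r 4) = hit X (AHM n r 3) := by
  rw [hit_AHM_of_subset (by omega) (by omega) hn hX h.nonempty,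
    h.hit_AHM_three hr hn (hX.trans (Icc_subset_Icc_right hn)), Nat.add_sub_add_right r 1 3]

lemma IsMLCIF.hit_lt_hit_AHM {F : Finset (Finset ℕ)} (h : IsLarge n r) (hm : 3 ≤ m)
    (hmr : m ≤ r + 1) (hmX : m ∈ X) (hX : X ⊆ Icc 2 m) (hF : IsMLCIF n r F)
    (hF3 : F ≠ AHM n r 3) (hFm : F ≠ AHM n r m) : hit X F < hit X (AHM n r m) := by
  have hn := h.two_mul_lt
  by_cases hpair : supersets n r {1, m} ⊆ F
  · exact hF.hit_lt_hit_AHM_of_supersets_pair_subset hn.le hm hmr hFm hX ⟨m, hmX⟩ hpair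
  · calc hit X F
      _ < hit X (star1 n r) := hF.hit_lt_hit_star1 h hF3 hmX (by omega) (by omega) hpair
      _ ≤ hit X (AHM n r m) :=
        hit_star1_le_hit_AHM (by omega) hmr (by omega) hX ⟨m, hmX⟩

lemma IsMLCIF.hit_lt_hit_AHM_three {F : Finset (Finset ℕ)} (h : IsLarge n r)
    (hexc : IsExceptional X) (hX : X ⊆ Icc 2 n) (hF : IsMLCIF n r F) (hF3 : F ≠ AHM n r 3)
    (hF4 : 4 ∈ X → F ≠ AHM n r 4) : hit X F < hit X (AHM n r 3) := by
  have hr := h.three_le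
  have hn := h.two_mul_lt
  obtain ⟨m, hmX, hm⟩ := hexc.exists_four_le hX
  have hXm := hexc.subset_Icc hX hmX hm
  by_cases hmr : m ≤ r + 1
  · obtain rfl | hm4 := hm.eq_or_lt
    · rw [← hexc.hit_AHM_four hr (by omega) hXm]
      exact hF.hit_lt_hit_AHM h (by omega) hmr hmX hXm hF3 (hF4 hmX)
    · have hlt : hit X (AHM n r m) < hit X (AHM n r 3) :=
        hexc.hit_AHM_lt_hit_AHM_three hm4 hmr (by omega) hXm
      by_cases hFm : F = AHM n r m
      · rwa [hFm]
      · exact (hF.hit_lt_hit_AHM h (by omega) hmr hmX hXm hF3 hFm).trans hlt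
  · calc hit X F
      _ ≤ hit X (star1 n r) := by
        by_cases hstar : F = star1 n r
        · rw [hstar]
        · exact (hF.hit_lt_hit_star1_of_not_subset h hstar hF3 hX
            fun hXr => hmr (mem_Icc.1 (hXr hmX)).2).le
      _ < hit X (AHM n r 3) := by
        rw [hexc.hit_AHM_three hr (by omega) hX]
        exact Nat.lt_add_of_pos_right (Nat.choose_pos (by omega))

end AHMThree

section Optimal

variable {n r : ℕ} {G : Finset (Finset ℕ)} {X : Finset ℕ} {𝒪 : Set (Finset (Finset ℕ))}

lemma setOf_isOptimalFor_eq (hG : G ∈ 𝒪) (h𝒪 : ∀ H ∈ 𝒪, IsMLCIF n r H ∧ hit X H = hit X G)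
    (hlt : ∀ F, IsMLCIF n r F → F ∉ 𝒪 → hit X F < hit X G) :
    {F | IsOptimalFor n r X F} = 𝒪 := by
  have hle (F) (hF : IsMLCIF n r F) : hit X F ≤ hit X G := by
    by_cases hF𝒪 : F ∈ 𝒪
    · exact (h𝒪 F hF𝒪).2.le
    · exact (hlt F hF hF𝒪).le
  ext F
  refine ⟨fun hF => ?_, fun hF => ⟨(h𝒪 F hF).1, fun F' hF' => (h𝒪 F hF).2 ▸ hle F' hF'⟩⟩
  by_contra hF𝒪
  exact (hlt F hF.1 hF𝒪).not_ge (hF.2 G (h𝒪 G hG).1)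

lemma setOf_isOptimalFor_eq_singleton (hG : IsMLCIF n r G)
    (hlt : ∀ F, IsMLCIF n r F → F ≠ G → hit X F < hit X G) :
    {F | IsOptimalFor n r X F} = {G} :=
  setOf_isOptimalFor_eq (Set.mem_singleton G) (by rintro _ rfl; exact ⟨hG, rfl⟩) hlt

lemma IsLarge.setOf_isOptimalFor_singleton_two (h : IsLarge n r) :
    {F | IsOptimalFor n r {2} F} = {AHM n r 3} := by
  have hr := h.three_le
  exact setOf_isOptimalFor_eq_singleton (isMLCIF_AHM h.two_mul_lt.le le_rfl (by omega))
    fun F hF hne => hF.hit_singleton_two_lt_hit_AHM_three h hne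

lemma IsExceptional.setOf_isOptimalFor_of_four_notMem (hexc : IsExceptional X) (h : IsLarge n r)
    (hX : X ⊆ Icc 2 n) (h4 : 4 ∉ X) : {F | IsOptimalFor n r X F} = {AHM n r 3} := by
  have hr := h.three_le
  exact setOf_isOptimalFor_eq_singleton (isMLCIF_AHM h.two_mul_lt.le le_rfl (by omega))
    fun F hF hne => hF.hit_lt_hit_AHM_three h hexc hX hne fun h4X => absurd h4X h4

lemma IsExceptional.setOf_isOptimalFor_of_four_mem (hexc : IsExceptional X) (h : IsLarge n r)
    (hX : X ⊆ Icc 2 n) (h4 : 4 ∈ X) :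
    {F | IsOptimalFor n r X F} = {AHM n r 3, AHM n r 4} := by
  have hr := h.three_le
  have hn := h.two_mul_lt
  refine setOf_isOptimalFor_eq (Set.mem_insert _ _) ?_ fun F hF hne => ?_
  · rintro _ (rfl | rfl)
    · exact ⟨isMLCIF_AHM h.two_mul_lt.le le_rfl (by omega), rfl⟩
    · exact ⟨isMLCIF_AHM h.two_mul_lt.le (by omega) (by omega),
        hexc.hit_AHM_four hr (by omega) (hexc.subset_Icc hX h4 le_rfl)⟩
  · obtain ⟨hF3, hF4⟩ : F ≠ AHM n r 3 ∧ F ≠ AHM n r 4 := by simpa using hne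
    exact hF.hit_lt_hit_AHM_three h hexc hX hF3 fun _ => hF4

lemma IsLarge.setOf_isOptimalFor_of_subset (h : IsLarge n r) (hX : X.Nonempty) (hX2 : X ≠ {2})
    (hexc : ¬ IsExceptional X) (hXr : X ⊆ Icc 2 (r + 1)) :
    {F | IsOptimalFor n r X F} = {AHM n r (X.max' hX)} := by
  have hr := h.three_le
  have hn := h.two_mul_lt
  have hmX := X.max'_mem hX
  have hXm : X ⊆ Icc 2 (X.max' hX) := fun x hx =>
    mem_Icc.2 ⟨(mem_Icc.1 (hXr hx)).1, X.le_max' x hx⟩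
  generalize X.max' hX = m at hmX hXm
  have hmr : m ≤ r + 1 := (mem_Icc.1 (hXr hmX)).2
  have hm : 3 ≤ m := by
    by_contra! hlt
    refine hX2 (hX.subset_singleton_iff.1 fun x hx => ?_)
    grind
  refine setOf_isOptimalFor_eq_singleton (isMLCIF_AHM h.two_mul_lt.le hm hmr) fun F hF hFm => ?_
  by_cases hF3 : F = AHM n r 3
  · subst hF3
    have hX3 : ¬ X ⊆ {2, 3} := fun hsub => by
      have : m = 2 ∨ m = 3 := by simpa using hsub hmX
      exact hFm (congrArg _ (by omega))
    calc hit X (AHM n r 3)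
      _ < hit X (star1 n r) :=
        h.hit_AHM_three_lt_hit_star1 (hXr.trans (Icc_subset_Icc_right (by omega))) hX3 hexc
      _ ≤ hit X (AHM n r m) := hit_star1_le_hit_AHM (by omega) hmr (by omega) hXm hX
  · exact hF.hit_lt_hit_AHM h hm hmr hmX hXm hF3 hFm

lemma IsLarge.setOf_isOptimalFor_of_not_subset (h : IsLarge n r) (hX : X ⊆ Icc 2 n)
    (hexc : ¬ IsExceptional X) (hXr : ¬ X ⊆ Icc 2 (r + 1)) :
    {F | IsOptimalFor n r X F} = {star1 n r} := by
  have hr := h.three_le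
  refine setOf_isOptimalFor_eq_singleton (isMLCIF_star1 (by omega) h.two_mul_lt.le)
    fun F hF hstar => ?_
  by_cases hF3 : F = AHM n r 3
  · subst hF3
    have h23 : ({2, 3} : Finset ℕ) ⊆ Icc 2 (r + 1) := by grind
    exact h.hit_AHM_three_lt_hit_star1 hX (fun hsub => hXr (hsub.trans h23)) hexc
  · exact hF.hit_lt_hit_star1_of_not_subset h hstar hF3 hX hXr

lemma eq_pair_or_isExceptional (hcard : #X = 2) (hmeet : (X ∩ {2, 3}).Nonempty) :
    X = {2, 3} ∨ IsExceptional X := by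
  refine or_iff_not_imp_left.2 fun hne => ⟨hmeet, ?_⟩
  have hsub : ¬ X ⊆ {2, 3} := fun hsub => hne (eq_of_subset_of_card_le hsub (by simp [hcard]))
  have := card_pos.2 (sdiff_nonempty.2 hsub)
  have := card_pos.2 hmeet
  have := card_inter_add_card_sdiff X {2, 3}
  omega

lemma isExceptional_of_card_eq_three (hcard : #X = 3) (h23 : {2, 3} ⊆ X) : IsExceptional X :=
  ⟨⟨2, mem_inter.2 ⟨h23 (by simp), by simp⟩⟩, by simp [card_sdiff_of_subset h23, hcard]⟩

lemma IsExceptional.card_eq (h : IsExceptional X) :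
    #X = 2 ∧ (X ∩ {2, 3}).Nonempty ∨ #X = 3 ∧ {2, 3} ⊆ X := by
  have hpos := card_pos.2 h.1
  have hle : #(X ∩ {2, 3}) ≤ #{2, 3} := card_le_card inter_subset_right
  have hadd := card_inter_add_card_sdiff X {2, 3}
  rw [h.2] at hadd
  obtain hone | htwo : #(X ∩ {2, 3}) = 1 ∨ #(X ∩ {2, 3}) = 2 := by
    rw [card_pair (by decide)] at hle
    omega
  · exact Or.inl ⟨by omega, h.1⟩
  · refine Or.inr ⟨by omega, ?_⟩
    rw [← inter_eq_right]
    exact eq_of_subset_of_card_le inter_subset_right (by simp [htwo])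

lemma eq_two_three_four_iff (hcard : #X = 3) (h23 : {2, 3} ⊆ X) : X = {2, 3, 4} ↔ 4 ∈ X := by
  refine ⟨by rintro rfl; simp, fun h4 => (eq_of_subset_of_card_le ?_ hcard.le).symm⟩
  grind

end Optimal

theorem theorem1p4 (r : ℕ) (hr : 3 ≤ r) :
    ∃ N : ℕ, ∀ n : ℕ, N ≤ n → ∀ X : Finset ℕ, X ⊆ Icc 2 n → ∀ hX : X.Nonempty,
      -- (a)
      (X = {2} → {F | IsOptimalFor n r X F} = {AHM n r 3}) ∧
      -- (b)
      (#X = 2 → (X ∩ {2, 3}).Nonempty →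
        (4 ∉ X → {F | IsOptimalFor n r X F} = {AHM n r 3}) ∧
        (4 ∈ X → {F | IsOptimalFor n r X F} = {AHM n r 3, AHM n r 4})) ∧
      -- (c)
      (#X = 3 → {2, 3} ⊆ X →
        (X ≠ {2, 3, 4} → {F | IsOptimalFor n r X F} = {AHM n r 3}) ∧
        (X = {2, 3, 4} → {F | IsOptimalFor n r X F} = {AHM n r 3, AHM n r 4})) ∧
      -- (d) and all remaining sets
      (X ≠ {2} → ¬ (#X = 2 ∧ (X ∩ {2, 3}).Nonempty) → ¬ (#X = 3 ∧ {2, 3} ⊆ X) →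
        (X ⊆ Icc 2 (r + 1) → {F | IsOptimalFor n r X F} = {AHM n r (X.max' hX)}) ∧
        (¬ X ⊆ Icc 2 (r + 1) → {F | IsOptimalFor n r X F} = {star1 n r})) := by
  obtain ⟨N, hN⟩ := exists_forall_isLarge hr
  refine ⟨N, fun n hn X hXn hX => ?_⟩
  have h := hN n hn
  refine ⟨?_, fun hcard hmeet => ?_, fun hcard h23 => ?_, fun h2 hpair htriple => ?_⟩
  · rintro rfl
    exact h.setOf_isOptimalFor_singleton_two
  · obtain rfl | hexc := eq_pair_or_isExceptional hcard hmeet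
    · refine ⟨fun _ => ?_, fun h4 => absurd h4 (by decide)⟩
      exact h.setOf_isOptimalFor_of_subset hX (by decide) (fun hexc => by simpa using hexc.2)
        (by grind)
    · exact ⟨hexc.setOf_isOptimalFor_of_four_notMem h hXn,
        hexc.setOf_isOptimalFor_of_four_mem h hXn⟩
  · have hexc := isExceptional_of_card_eq_three hcard h23
    rw [ne_eq, eq_two_three_four_iff hcard h23]
    exact ⟨hexc.setOf_isOptimalFor_of_four_notMem h hXn,
      hexc.setOf_isOptimalFor_of_four_mem h hXn⟩
  · have hexc : ¬ IsExceptional X := fun hexc => hexc.card_eq.elim hpair htriple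
    exact ⟨h.setOf_isOptimalFor_of_subset hX h2 hexc,
      h.setOf_isOptimalFor_of_not_subset hXn hexc⟩
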